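/- Let $L$ be a frame with a point $*\colon L\to\{\bot,\top\}$ (a frame homomorphism), and let $\mathcal{R}_0L$ be the set of frame homomorphisms $g\colon\mathcal{O}\mathbb{R}\to L$ from the frame of open subsets of $\mathbb{R}$ such that $*(g(U))=\top$ iff $0\in U$. A continuous $w\colon\mathbb{R}^n\to\mathbb{R}$ with $w(0)=0$ acts on $\mathcal{R}_0L$ by $w(f_1,\dots,f_n)(V)=\bigvee\{f_1(U_1)\wedge\dots\wedge f_n(U_n) : w(U_1\times\dots\times U_n)\subseteq V\}$; in this way $\mathcal{R}_0L$ is a vector lattice, and $x\mapsto\min(x,1)$ induces a truncation $g\mapsto\overline{g}$ on its positive cone. Let $G\subseteq\mathcal{R}_0L$ be a subtrunc, i.e. a linear subspace closed under $\vee$, $\wedge$ and the truncation of positive elements (for instance $G=\mathcal{R}_0L$), with positive cone $G^+$, and let $\overline{G}=\{\overline{g}: g\in G^+\}$. A sequence $\{g_n\}_{n\ge1}$ in $G^+$ is a truncation sequence if there is $0\le g\in\mathcal{R}_0L$ with $g_n=g\wedge n:=n\,\overline{g/n}$ for all $n\ge1$. A sequence $\{f_n\}_{n\ge1}$ in $\overline{G}$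 is a good sequence if $f_n=\overline{f_n+f_{n+1}}$ for all $n\ge1$ and $f_n\searrow0$ pointwise, i.e. $f_{n+1}\le f_n$ for all $n$ and $\bigvee_n f_n(-\infty,r)=0(-\infty,r)$ for all $r\in\mathbb{R}$, where $0\in\mathcal{R}_0L$ takes $U$ to $\top$ if $0\in U$ and to $\bot$ otherwise. If $\{g_n\}$ is a truncation sequence then the sequence of differences $\{g_n-g_{n-1}\}_{n\ge1}$, with $g_0:=0$, is a good sequence. If $\{f_n\}$ is a good sequence then the sequence of partial sums $\{\sum_{1\le n\le m}f_n\}_{m\ge1}$ is a truncation sequence. These two maps are inverse to each other, so that the truncation sequences are in bijective correspondence with the good sequences. -/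

import Mathlib

open TopologicalSpace

namespace PointfreeTrunc

universe u

section Pairing

variable {L : Type u} [Order.Frame L]
variable {X Y Z : Type} [TopologicalSpace X] [TopologicalSpace Y] [TopologicalSpace Z]

/-- The open rectangle `U × V`. -/
def rect (U : Opens X) (V : Opens Y) : Opens (X × Y) :=
  ⟨(U : Set X) ×ˢ (V : Set Y), U.2.prod V.2⟩

/-- Two frame homomorphisms on the open sets of a product agree if they agree on the
inverse images under the two projections. -/
theorem hom_ext_prod {h k : FrameHom (Opens (X × Y)) L}
    (h1 : ∀ U, h (Opens.comap ⟨Prod.fst, continuous_fst⟩ U) =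
      k (Opens.comap ⟨Prod.fst, continuous_fst⟩ U))
    (h2 : ∀ V, h (Opens.comap ⟨Prod.snd, continuous_snd⟩ V) =
      k (Opens.comap ⟨Prod.snd, continuous_snd⟩ V)) : h = k := by
  have hrect : ∀ (U : Opens X) (V : Opens Y), h (rect U V) = k (rect U V) := by
    intro U V
    have : rect U V = Opens.comap ⟨Prod.fst, continuous_fst⟩ U ⊓
        Opens.comap ⟨Prod.snd, continuous_snd⟩ V := by
      rfl
    rw [this, map_inf, map_inf, h1, h2]
  ext W
  have hW : W = sSup {R | ∃ (U : Opens X) (V : Opens Y), R = rect U V ∧ R ≤ W} := by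
    apply le_antisymm
    · rintro ⟨x, y⟩ hxy
      obtain ⟨U, V, hU, hV, hx, hy, hs⟩ := isOpen_prod_iff.1 W.2 x y hxy
      simp only [Opens.mem_sSup]
      exact ⟨rect ⟨U, hU⟩ ⟨V, hV⟩, ⟨_, _, rfl, hs⟩, hx, hy⟩
    · apply sSup_le
      rintro R ⟨U, V, rfl, h⟩
      exact h
  rw [hW, map_sSup, map_sSup]
  congr 1
  ext a
  constructor
  · rintro ⟨R, ⟨U, V, rfl, h'⟩, rfl⟩
    exact ⟨_, ⟨U, V, rfl, h'⟩, (hrect U V).symm⟩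
  · rintro ⟨R, ⟨U, V, rfl, h'⟩, rfl⟩
    exact ⟨_, ⟨U, V, rfl, h'⟩, hrect U V⟩

/-- The join of all `f U ⊓ g V` over the open rectangles `U ×ˢ V` contained in `W`. -/
def pairFun (f : FrameHom (Opens X) L) (g : FrameHom (Opens Y) L) (W : Opens (X × Y)) : L :=
  ⨆ (U : Opens X) (V : Opens Y) (_ : (U : Set X) ×ˢ (V : Set Y) ⊆ (W : Set (X × Y))), f U ⊓ g V

theorem le_pairFun (f : FrameHom (Opens X) L) (g : FrameHom (Opens Y) L) {W : Opens (X × Y)}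
    (U : Opens X) (V : Opens Y) (h : (U : Set X) ×ˢ (V : Set Y) ⊆ (W : Set (X × Y))) :
    f U ⊓ g V ≤ pairFun f g W :=
  le_iSup_of_le U (le_iSup_of_le V (le_iSup_of_le h le_rfl))

theorem pairFun_mono (f : FrameHom (Opens X) L) (g : FrameHom (Opens Y) L)
    {W W' : Opens (X × Y)} (h : W ≤ W') : pairFun f g W ≤ pairFun f g W' :=
  iSup_le fun U => iSup_le fun V => iSup_le fun hs => le_pairFun f g U V (hs.trans h)

theorem pairFun_sSup [LocallyCompactSpace Y]
    (f : FrameHom (Opens X) L) (g : FrameHom (Opens Y) L)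
    (S : Set (Opens (X × Y))) : pairFun f g (sSup S) = sSup (pairFun f g '' S) := by
  apply le_antisymm
  · refine iSup_le fun A => iSup_le fun B => iSup_le fun hAB => ?_
    set Q := sSup (pairFun f g '' S) with hQ
    have key : ∀ (K : Set Y), IsCompact K → K ⊆ B → ∀ x ∈ A,
        ∃ N : Opens X, x ∈ N ∧ ∃ B' : Opens Y, K ⊆ B' ∧ f N ⊓ g B' ≤ Q := by
      intro K hK hKB x hx
      refine hK.induction_on
        (p := fun K => ∃ N : Opens X, x ∈ N ∧ ∃ B' : Opens Y, K ⊆ B' ∧ f N ⊓ g B' ≤ Q)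
        ?_ ?_ ?_ ?_
      · exact ⟨⊤, trivial, ⊥, Set.empty_subset _, by simp⟩
      · rintro s t hst ⟨N, hN, B', hB, h⟩
        exact ⟨N, hN, B', hst.trans hB, h⟩
      · rintro s t ⟨N, hN, B', hB, h⟩ ⟨N2, hN2, B2, hB2, h2⟩
        refine ⟨N ⊓ N2, ⟨hN, hN2⟩, B' ⊔ B2, ?_, ?_⟩
        · rw [Opens.coe_sup]; exact Set.union_subset_union hB hB2
        · rw [map_inf, map_sup, inf_sup_left]
          exact sup_le (le_trans (inf_le_inf_right _ inf_le_left) h)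
            (le_trans (inf_le_inf_right _ inf_le_right) h2)
      · intro y hy
        have hxy : (x, y) ∈ sSup S := hAB ⟨hx, hKB hy⟩
        obtain ⟨W, hWS, hW⟩ := Opens.mem_sSup.1 hxy
        obtain ⟨U, V, hU, hV, hxU, hyV, hs⟩ := isOpen_prod_iff.1 W.2 x y hW
        refine ⟨V, mem_nhdsWithin_of_mem_nhds (hV.mem_nhds hyV), ⟨U, hU⟩, hxU, ⟨V, hV⟩,
          subset_rfl, ?_⟩
        exact (le_pairFun f g (W := W) ⟨U, hU⟩ ⟨V, hV⟩ hs).trans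
          (le_sSup (Set.mem_image_of_mem _ hWS))
    have step : ∀ B0 : Opens Y, (∃ K : Set Y, IsCompact K ∧ K ⊆ B ∧ (B0 : Set Y) ⊆ K) →
        f A ⊓ g B0 ≤ Q := by
      rintro B0 ⟨K, hK, hKB, hB0⟩
      have hA : A ≤ sSup {N : Opens X | f N ⊓ g B0 ≤ Q} := by
        intro x hx
        obtain ⟨N, hN, B', hB', h⟩ := key K hK hKB x hx
        exact Opens.mem_sSup.2
          ⟨N, (inf_le_inf_left _ (OrderHomClass.mono g (hB0.trans hB'))).trans h, hN⟩
      refine (inf_le_inf_right _ (OrderHomClass.mono f hA)).trans ?_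
      rw [map_sSup, sSup_inf_eq]
      refine iSup₂_le ?_
      rintro _ ⟨N, hN, rfl⟩
      exact hN
    have hB : B ≤ sSup {B0 : Opens Y | ∃ K : Set Y, IsCompact K ∧ K ⊆ B ∧ (B0 : Set Y) ⊆ K} := by
      intro y hy
      obtain ⟨K, hK, hyK, hKB⟩ := exists_compact_subset B.2 hy
      exact Opens.mem_sSup.2 ⟨⟨interior K, isOpen_interior⟩, ⟨K, hK, hKB, interior_subset⟩, hyK⟩
    refine (inf_le_inf_left _ (OrderHomClass.mono g hB)).trans ?_
    rw [map_sSup, inf_sSup_eq]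
    refine iSup₂_le ?_
    rintro _ ⟨N, hN, rfl⟩
    exact step N hN
  · apply sSup_le
    rintro _ ⟨W, hW, rfl⟩
    exact pairFun_mono f g (le_sSup hW)

/-- The frame homomorphism on the open sets of `X × Y` determined by `f` and `g`. -/
def pair [LocallyCompactSpace Y] (f : FrameHom (Opens X) L) (g : FrameHom (Opens Y) L) :
    FrameHom (Opens (X × Y)) L where
  toFun := pairFun f g
  map_inf' W W' := by
    apply le_antisymm
    · exact le_inf (pairFun_mono f g inf_le_left) (pairFun_mono f g inf_le_right)
    · simp only [pairFun, iSup_inf_eq, inf_iSup_eq]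
      refine iSup_le fun U => iSup_le fun V => iSup_le fun h => iSup_le fun U' =>
        iSup_le fun V' => iSup_le fun h' => ?_
      refine le_trans ?_ (le_pairFun f g (W := W ⊓ W') (U' ⊓ U) (V' ⊓ V) ?_)
      · rw [map_inf, map_inf]
        exact le_of_eq (inf_inf_inf_comm _ _ _ _)
      · rintro ⟨x, y⟩ ⟨hx, hy⟩
        exact ⟨h' ⟨hx.1, hy.1⟩, h ⟨hx.2, hy.2⟩⟩
  map_top' := by
    refine top_le_iff.1 (le_trans ?_ (le_pairFun f g (W := ⊤) ⊤ ⊤ (Set.subset_univ _)))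
    simp
  map_sSup' := pairFun_sSup f g

theorem pair_fst [LocallyCompactSpace Y] (f : FrameHom (Opens X) L) (g : FrameHom (Opens Y) L) :
    (pair f g).comp (Opens.comap ⟨Prod.fst, continuous_fst⟩) = f := by
  ext U
  apply le_antisymm
  · refine iSup_le fun A => iSup_le fun B => iSup_le fun h => ?_
    rcases (B : Set Y).eq_empty_or_nonempty with hB | ⟨y, hy⟩
    · have : B = ⊥ := Opens.ext hB
      simp [this]
    · refine inf_le_left.trans (OrderHomClass.mono f ?_)
      intro x hx
      exact h (⟨hx, hy⟩ : (x, y) ∈ (A : Set X) ×ˢ (B : Set Y))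
  · refine le_trans ?_ (le_pairFun f g U ⊤ ?_)
    · simp
    · rintro ⟨x, y⟩ ⟨hx, _⟩
      exact hx

theorem pair_snd [LocallyCompactSpace Y] (f : FrameHom (Opens X) L) (g : FrameHom (Opens Y) L) :
    (pair f g).comp (Opens.comap ⟨Prod.snd, continuous_snd⟩) = g := by
  ext U
  apply le_antisymm
  · refine iSup_le fun A => iSup_le fun B => iSup_le fun h => ?_
    rcases (A : Set X).eq_empty_or_nonempty with hA | ⟨x, hx⟩
    · have : A = ⊥ := Opens.ext hA
      simp [this]
    · refine inf_le_right.trans (OrderHomClass.mono g ?_)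
      intro y hy
      exact h (⟨hx, hy⟩ : (x, y) ∈ (A : Set X) ×ˢ (B : Set Y))
  · refine le_trans ?_ (le_pairFun f g ⊤ U ?_)
    · simp
    · rintro ⟨x, y⟩ ⟨_, hy⟩
      exact hy

theorem pair_comap [LocallyCompactSpace Y] (T : FrameHom (Opens Z) L) (a : C(Z, X)) (b : C(Z, Y)) :
    pair (T.comp (Opens.comap a)) (T.comp (Opens.comap b)) =
      T.comp (Opens.comap (a.prodMk b)) := by
  apply hom_ext_prod
  · intro U
    exact DFunLike.congr_fun (pair_fst (T.comp (Opens.comap a)) (T.comp (Opens.comap b))) U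
  · intro V
    exact DFunLike.congr_fun (pair_snd (T.comp (Opens.comap a)) (T.comp (Opens.comap b))) V

end Pairing

/-- For a frame `L` with point `pt` (a frame homomorphism into the two-element frame, here `Prop`),
`R0 pt` is the family `𝓡₀ L` of pointed frame homomorphisms from the open sets of the reals, with
the point `U ↦ (0 ∈ U)`, to `L`. -/
@[ext]
structure R0 {L : Type u} [Order.Frame L] (pt : FrameHom L Prop) where
  /-- The underlying frame homomorphism. -/
  hom : FrameHom (Opens ℝ) L
  pointed : ∀ U : Opens ℝ, pt (hom U) ↔ (0 : ℝ) ∈ U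

namespace R0

variable {L : Type u} [Order.Frame L] {pt : FrameHom L Prop}

/-- The unary operation on `𝓡₀ L` induced by a continuous function `w` with `w 0 = 0`. -/
def map (w : C(ℝ, ℝ)) (hw : w 0 = 0) (f : R0 pt) : R0 pt where
  hom := f.hom.comp (Opens.comap w)
  pointed U := by
    change pt (f.hom (Opens.comap w U)) ↔ _
    rw [f.pointed, Opens.mem_comap, hw]

/-- The binary operation on `𝓡₀ L` induced by a continuous function `w` with `w (0, 0) = 0`:
`w(f, g)(V)` is the join of all `f U₁ ⊓ g U₂` with `w(U₁ × U₂) ⊆ V`. -/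
def map₂ (w : C(ℝ × ℝ, ℝ)) (hw : w (0, 0) = 0) (f g : R0 pt) : R0 pt where
  hom := (pair f.hom g.hom).comp (Opens.comap w)
  pointed V := by
    have hpt : ∀ a b : L, pt (a ⊓ b) ↔ pt a ∧ pt b := fun a b => by rw [map_inf]; rfl
    change pt (pairFun f.hom g.hom (Opens.comap w V)) ↔ _
    constructor
    · intro h
      simp only [pairFun, map_iSup, iSup_Prop_eq, hpt, f.pointed, g.pointed] at h
      obtain ⟨U₁, U₂, hs, h1, h2⟩ := h
      have := hs (⟨h1, h2⟩ : ((0 : ℝ), (0 : ℝ)) ∈ (U₁ : Set ℝ) ×ˢ (U₂ : Set ℝ))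
      change w (0, 0) ∈ V at this
      rwa [hw] at this
    · intro h
      have h0 : ((0 : ℝ), (0 : ℝ)) ∈ Opens.comap w V := by
        rw [Opens.mem_comap, hw]; exact h
      obtain ⟨U₁, U₂, hU₁, hU₂, h1, h2, hs⟩ := isOpen_prod_iff.1 (Opens.comap w V).2 _ _ h0
      refine OrderHomClass.mono pt (le_pairFun f.hom g.hom ⟨U₁, hU₁⟩ ⟨U₂, hU₂⟩ hs) ?_
      rw [hpt, f.pointed, g.pointed]
      exact ⟨h1, h2⟩

/-- The frame homomorphism of the constant `0`: it takes `U` to `⊤` if `0 ∈ U` and to `⊥` if not. -/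
def zeroHom : FrameHom (Opens ℝ) L where
  toFun U := ⨆ _ : (0 : ℝ) ∈ U, ⊤
  map_inf' U V := by
    by_cases h : (0 : ℝ) ∈ U <;> by_cases h' : (0 : ℝ) ∈ V <;> simp [h, h']
  map_top' := by simp
  map_sSup' S := by
    apply le_antisymm
    · refine iSup_le fun h => ?_
      obtain ⟨U, hU, h0⟩ := Opens.mem_sSup.1 h
      exact le_trans (le_iSup (fun _ : (0 : ℝ) ∈ U => (⊤ : L)) h0)
        (le_sSup (Set.mem_image_of_mem (fun U : Opens ℝ => ⨆ _ : (0 : ℝ) ∈ U, (⊤ : L)) hU))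
    · apply sSup_le
      rintro _ ⟨U, hU, rfl⟩
      exact iSup_le fun h => le_iSup_of_le (Opens.mem_sSup.2 ⟨U, hU, h⟩) le_rfl

instance : Zero (R0 pt) where
  zero := ⟨zeroHom, fun U => by
    change pt (⨆ _ : (0 : ℝ) ∈ U, ⊤) ↔ _
    by_cases h : (0 : ℝ) ∈ U <;> simp [h]⟩

instance : Add (R0 pt) where
  add := map₂ ⟨fun x => x.1 + x.2, by fun_prop⟩ (by simp)

instance : Neg (R0 pt) where
  neg := map ⟨fun x => -x, by fun_prop⟩ (by simp)

instance : Sub (R0 pt) where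
  sub := map₂ ⟨fun x => x.1 - x.2, by fun_prop⟩ (by simp)

instance : SMul ℝ (R0 pt) where
  smul r := map ⟨fun x => r * x, by fun_prop⟩ (by simp)

instance : Max (R0 pt) where
  max := map₂ ⟨fun x => max x.1 x.2, by fun_prop⟩ (by simp)

instance : Min (R0 pt) where
  min := map₂ ⟨fun x => min x.1 x.2, by fun_prop⟩ (by simp)

/-- The truncation `g ↦ ḡ`, induced by `x ↦ x ∧ 1`. -/
def trunc : R0 pt → R0 pt :=
  map ⟨fun x => min x 1, by fun_prop⟩ (by simp)

section Transfer

variable {Z : Type} [TopologicalSpace Z]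

/-- `f` is the composite of `T` with the inverse image map of `a`. -/
def Rep (T : FrameHom (Opens Z) L) (f : R0 pt) (a : C(Z, ℝ)) : Prop :=
  f.hom = T.comp (Opens.comap a)

theorem Rep.map {T : FrameHom (Opens Z) L} {f : R0 pt} {a : C(Z, ℝ)} (h : Rep T f a)
    (w : C(ℝ, ℝ)) (hw : w 0 = 0) : Rep T (R0.map w hw f) (w.comp a) := by
  unfold Rep at *
  change f.hom.comp _ = _
  rw [h]; rfl

theorem Rep.map₂ {T : FrameHom (Opens Z) L} {f g : R0 pt} {a b : C(Z, ℝ)} (h : Rep T f a)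
    (h' : Rep T g b) (w : C(ℝ × ℝ, ℝ)) (hw : w (0, 0) = 0) :
    Rep T (R0.map₂ w hw f g) (w.comp (a.prodMk b)) := by
  unfold Rep at *
  change (pair f.hom g.hom).comp _ = _
  rw [h, h', pair_comap]; rfl

theorem Rep.zero (T : FrameHom (Opens Z) L) : Rep T (0 : R0 pt) 0 := by
  unfold Rep
  ext U
  change (⨆ _ : (0 : ℝ) ∈ U, ⊤) = T (Opens.comap 0 U)
  by_cases h : (0 : ℝ) ∈ U
  · have : Opens.comap (0 : C(Z, ℝ)) U = ⊤ := by
      ext z; simpa using h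
    rw [this]; simp [h]
  · have : Opens.comap (0 : C(Z, ℝ)) U = ⊥ := by
      ext z; simpa using h
    rw [this]; simp [h]

theorem Rep.add {T : FrameHom (Opens Z) L} {f g : R0 pt} {a b : C(Z, ℝ)} (h : Rep T f a)
    (h' : Rep T g b) : Rep T (f + g) (a + b) := h.map₂ h' _ _

theorem Rep.sub {T : FrameHom (Opens Z) L} {f g : R0 pt} {a b : C(Z, ℝ)} (h : Rep T f a)
    (h' : Rep T g b) : Rep T (f - g) (a - b) := h.map₂ h' _ _

theorem Rep.sup {T : FrameHom (Opens Z) L} {f g : R0 pt} {a b : C(Z, ℝ)} (h : Rep T f a)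
    (h' : Rep T g b) : Rep T (max f g) (a ⊔ b) := h.map₂ h' _ _

theorem Rep.inf {T : FrameHom (Opens Z) L} {f g : R0 pt} {a b : C(Z, ℝ)} (h : Rep T f a)
    (h' : Rep T g b) : Rep T (min f g) (a ⊓ b) := h.map₂ h' _ _

theorem Rep.neg {T : FrameHom (Opens Z) L} {f : R0 pt} {a : C(Z, ℝ)} (h : Rep T f a) :
    Rep T (-f) (-a) := h.map _ _

theorem Rep.smul {T : FrameHom (Opens Z) L} {f : R0 pt} {a : C(Z, ℝ)} (h : Rep T f a) (r : ℝ) :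
    Rep T (r • f) (r • a) := h.map _ _

theorem Rep.eq {T : FrameHom (Opens Z) L} {f g : R0 pt} {a b : C(Z, ℝ)} (h : Rep T f a)
    (h' : Rep T g b) (hab : a = b) : f = g := by
  subst hab
  exact R0.ext (h.trans h'.symm)

end Transfer

theorem exists_rep₃ (f g h : R0 pt) : ∃ (T : FrameHom (Opens (ℝ × ℝ × ℝ)) L)
    (a b c : C(ℝ × ℝ × ℝ, ℝ)), Rep T f a ∧ Rep T g b ∧ Rep T h c := by
  refine ⟨pair f.hom (pair g.hom h.hom), ⟨Prod.fst, continuous_fst⟩,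
    ⟨fun x => x.2.1, by fun_prop⟩, ⟨fun x => x.2.2, by fun_prop⟩, ?_, ?_, ?_⟩
  · exact (pair_fst _ _).symm
  · change _ = ((pair f.hom (pair g.hom h.hom)).comp
      (Opens.comap ⟨Prod.snd, continuous_snd⟩)).comp (Opens.comap ⟨Prod.fst, continuous_fst⟩)
    rw [pair_snd, pair_fst]
  · change _ = ((pair f.hom (pair g.hom h.hom)).comp
      (Opens.comap ⟨Prod.snd, continuous_snd⟩)).comp (Opens.comap ⟨Prod.snd, continuous_snd⟩)
    rw [pair_snd, pair_snd]

instance : AddCommGroup (R0 pt) where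
  add_assoc f g h := by
    obtain ⟨T, a, b, c, ha, hb, hc⟩ := exists_rep₃ f g h
    exact ((ha.add hb).add hc).eq (ha.add (hb.add hc)) (add_assoc a b c)
  zero_add f := by
    obtain ⟨T, a, b, c, ha, hb, hc⟩ := exists_rep₃ f f f
    exact ((Rep.zero T).add ha).eq ha (zero_add a)
  add_zero f := by
    obtain ⟨T, a, b, c, ha, hb, hc⟩ := exists_rep₃ f f f
    exact (ha.add (Rep.zero T)).eq ha (add_zero a)
  add_comm f g := by
    obtain ⟨T, a, b, c, ha, hb, hc⟩ := exists_rep₃ f g g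
    exact (ha.add hb).eq (hb.add ha) (add_comm a b)
  neg_add_cancel f := by
    obtain ⟨T, a, b, c, ha, hb, hc⟩ := exists_rep₃ f f f
    exact (ha.neg.add ha).eq (Rep.zero T) (neg_add_cancel a)
  sub_eq_add_neg f g := by
    obtain ⟨T, a, b, c, ha, hb, hc⟩ := exists_rep₃ f g g
    exact (ha.sub hb).eq (ha.add hb.neg) (sub_eq_add_neg a b)
  nsmul := nsmulRec
  zsmul := zsmulRec

instance : Module ℝ (R0 pt) where
  one_smul f := by
    obtain ⟨T, a, b, c, ha, hb, hc⟩ := exists_rep₃ f f f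
    exact (ha.smul 1).eq ha (one_smul ℝ a)
  mul_smul r s f := by
    obtain ⟨T, a, b, c, ha, hb, hc⟩ := exists_rep₃ f f f
    exact (ha.smul (r * s)).eq ((ha.smul s).smul r) (mul_smul r s a)
  smul_zero r := by
    obtain ⟨T, a, b, c, ha, hb, hc⟩ := exists_rep₃ (0 : R0 pt) 0 0
    exact ((Rep.zero T).smul r).eq (Rep.zero T) (smul_zero r)
  smul_add r f g := by
    obtain ⟨T, a, b, c, ha, hb, hc⟩ := exists_rep₃ f g g
    exact ((ha.add hb).smul r).eq ((ha.smul r).add (hb.smul r)) (smul_add r a b)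
  add_smul r s f := by
    obtain ⟨T, a, b, c, ha, hb, hc⟩ := exists_rep₃ f f f
    exact (ha.smul (r + s)).eq ((ha.smul r).add (ha.smul s)) (add_smul r s a)
  zero_smul f := by
    obtain ⟨T, a, b, c, ha, hb, hc⟩ := exists_rep₃ f f f
    exact (ha.smul 0).eq (Rep.zero T) (zero_smul ℝ a)

/-- The lattice structure of `𝓡₀ L`; the order is the one of the lattice operations,
`f ≤ g ↔ f ⊔ g = g`. -/
instance : Lattice (R0 pt) :=
  Lattice.mk'
    (fun f g => by
      obtain ⟨T, a, b, c, ha, hb, hc⟩ := exists_rep₃ f g g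
      exact (ha.sup hb).eq (hb.sup ha) (sup_comm a b))
    (fun f g h => by
      obtain ⟨T, a, b, c, ha, hb, hc⟩ := exists_rep₃ f g h
      exact ((ha.sup hb).sup hc).eq (ha.sup (hb.sup hc)) (sup_assoc a b c))
    (fun f g => by
      obtain ⟨T, a, b, c, ha, hb, hc⟩ := exists_rep₃ f g g
      exact (ha.inf hb).eq (hb.inf ha) (inf_comm a b))
    (fun f g h => by
      obtain ⟨T, a, b, c, ha, hb, hc⟩ := exists_rep₃ f g h
      exact ((ha.inf hb).inf hc).eq (ha.inf (hb.inf hc)) (inf_assoc a b c))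
    (fun f g => by
      obtain ⟨T, a, b, c, ha, hb, hc⟩ := exists_rep₃ f g g
      exact (ha.sup (ha.inf hb)).eq ha sup_inf_self)
    (fun f g => by
      obtain ⟨T, a, b, c, ha, hb, hc⟩ := exists_rep₃ f g g
      exact (ha.inf (ha.sup hb)).eq ha inf_sup_self)

/-- The truncation `g ∧ n`, i.e. `n` times the truncation of `g / n`, for `n ≥ 1`. -/
noncomputable def truncAt (g : R0 pt) (n : ℕ) : R0 pt :=
  (n : ℝ) • trunc ((1 / (n : ℝ)) • g)

/-- The open set `(-∞, r)`. -/
def below (r : ℝ) : Opens ℝ := ⟨Set.Iio r, isOpen_Iio⟩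

/-- `f` converges pointwise downwards to `b`: it is decreasing, and `b` is the
pointwise infimum of its terms. -/
def ConvergesDown (f : ℕ → R0 pt) (b : R0 pt) : Prop :=
  (∀ n, f (n + 1) ≤ f n) ∧ ∀ r : ℝ, ⨆ n, (f n).hom (below r) = b.hom (below r)

end R0

open R0

/-- A subtrunc of `𝓡₀ L`: a linear subspace closed under the lattice operations and under
the truncation of its positive elements. -/
structure Subtrunc {L : Type u} [Order.Frame L] (pt : FrameHom L Prop)
    extends Submodule ℝ (R0 pt) where
  sup_mem : ∀ f g : R0 pt, f ∈ carrier → g ∈ carrier → f ⊔ g ∈ carrier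
  inf_mem : ∀ f g : R0 pt, f ∈ carrier → g ∈ carrier → f ⊓ g ∈ carrier
  trunc_mem : ∀ g : R0 pt, g ∈ carrier → 0 ≤ g → trunc g ∈ carrier

section Sequences

variable {L : Type u} [Order.Frame L] {pt : FrameHom L Prop}

/-- The whole of `𝓡₀ L` as a subtrunc of itself. -/
instance : Top (Subtrunc pt) where
  top := { (⊤ : Submodule ℝ (R0 pt)) with
    sup_mem := fun _ _ _ _ => trivial
    inf_mem := fun _ _ _ _ => trivial
    trunc_mem := fun _ _ _ => trivial }

/-- The positive cone of a subtrunc. -/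
def Subtrunc.posCone (G : Subtrunc pt) : Set (R0 pt) := {g | g ∈ G.carrier ∧ 0 ≤ g}

/-- The range of the truncation on the positive cone of a subtrunc. -/
def Subtrunc.truncRange (G : Subtrunc pt) : Set (R0 pt) := trunc '' G.posCone

/-- A sequence `g₁, g₂, …` in the positive cone of `G` is a truncation sequence if it is the
sequence `g ∧ 1, g ∧ 2, …` of some positive `g` in `𝓡₀ L`. (Sequences are indexed so that
`g k` is the term number `k + 1`.) -/
def IsTruncationSeq (G : Subtrunc pt) (g : ℕ → R0 pt) : Prop :=
  (∀ k, g k ∈ G.posCone) ∧ ∃ g₀ : R0 pt, 0 ≤ g₀ ∧ ∀ k, g k = truncAt g₀ (k + 1)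

/-- A sequence `f₁, f₂, …` in the range of the truncation of `G` is a good sequence if
each `fₙ` is the truncation of `fₙ + fₙ₊₁` and the sequence converges pointwise downwards to `0`. -/
def IsGoodSeq (G : Subtrunc pt) (f : ℕ → R0 pt) : Prop :=
  (∀ k, f k ∈ G.truncRange) ∧ (∀ k, f k = trunc (f k + f (k + 1))) ∧ ConvergesDown f 0

/-- The sequence of differences `g₁ - g₀, g₂ - g₁, …`, with `g₀ = 0`. -/
def differences (g : ℕ → R0 pt) : ℕ → R0 pt
  | 0 => g 0
  | k + 1 => g (k + 1) - g k

/-- The sequence of partial sums `f₁, f₁ + f₂, …`. -/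
def partialSums (f : ℕ → R0 pt) (m : ℕ) : R0 pt := ∑ k ∈ Finset.range (m + 1), f k

end Sequences

end PointfreeTrunc

/-! If `f` and `g` are pulled back along one frame map `T` from continuous functions `a` and `b` on
a space, then `f = g` or `f ≤ g` holds exactly when `a = b` or `a ≤ b` off an open set that `T`
kills (`Rep.eq_iff`, `Rep.le_iff`). Identities in `R0 pt` thus become arithmetic of real numbers,
even when they hold only under hypotheses.

The differences of `g₀ ∧ 1, g₀ ∧ 2, …` are the slices `min (max (x - k) 0) 1` of `x ≥ 0`. Two
consecutive slices add up to one whose truncation is the lower slice, and by the Archimedean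
property the slices vanish eventually at each point.

Conversely, the partial sums `s m` of a good sequence satisfy `s m = s (m + 1) ∧ (m + 1)`: a term
can be positive only where all earlier terms have reached `1`. Such a coherent sequence is constant
from `m` on wherever `s m < m + 1`. Convergence to `0` says that these regions cover `L`, so the
sequence glues to one element whose truncations are the `s m` (`truncAt_glue`). Telescoping makes
the two maps mutually inverse. -/

namespace PointfreeTrunc

/-! ### Open sets killed by a frame homomorphism -/

section NullFilter

variable {L : Type*} [Order.Frame L] {Z : Type} [TopologicalSpace Z]

/-- The filter of sets whose complement is covered by an open set that `T` takes to `⊥`. -/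
def nullFilter (T : FrameHom (Opens Z) L) : Filter Z where
  sets := {s | ∃ D : Opens Z, T D = ⊥ ∧ ∀ z ∉ D, z ∈ s}
  univ_sets := ⟨⊥, map_bot T, fun _ _ => trivial⟩
  sets_of_superset := by
    rintro s t ⟨D, hD, h⟩ hst
    exact ⟨D, hD, fun z hz => hst (h z hz)⟩
  inter_sets := by
    rintro s t ⟨D, hD, h⟩ ⟨E, hE, h'⟩
    refine ⟨D ⊔ E, by rw [map_sup, hD, hE, sup_bot_eq], fun z hz => ⟨h z fun hd => hz ?_,
      h' z fun hd => hz ?_⟩⟩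
    · exact Or.inl hd
    · exact Or.inr hd

theorem eventually_nullFilter {T : FrameHom (Opens Z) L} {p : Z → Prop} :
    (∀ᶠ z in nullFilter T, p z) ↔ ∃ D : Opens Z, T D = ⊥ ∧ ∀ z ∉ D, p z := Iff.rfl

theorem map_le_of_eventually {T : FrameHom (Opens Z) L} {U V : Opens Z}
    (h : ∀ᶠ z in nullFilter T, z ∈ U → z ∈ V) : T U ≤ T V := by
  obtain ⟨D, hD, h⟩ := eventually_nullFilter.1 h
  have hU : U ≤ V ⊔ D := by
    intro z hz
    by_cases hzD : z ∈ D
    · exact Or.inr hzD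
    · exact Or.inl (h z hzD hz)
  calc T U ≤ T (V ⊔ D) := OrderHomClass.mono T hU
    _ = T V := by rw [map_sup, hD, sup_bot_eq]

end NullFilter

namespace R0

/-! ### Transfer of relations in `R0 pt` to real functions -/

section Transfer

variable {L : Type*} [Order.Frame L] {pt : FrameHom L Prop} {Z : Type} [TopologicalSpace Z]
  {T : FrameHom (Opens Z) L} {f g : R0 pt} {a b : C(Z, ℝ)}

theorem Rep.apply (h : Rep T f a) (U : Opens ℝ) : f.hom U = T (Opens.comap a U) := by
  rw [h]; rfl

theorem rep_id (f : R0 pt) : Rep f.hom f (ContinuousMap.id ℝ) := rfl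

/-- The set where `b < a` is covered by the sets `b < q < a`. Since `a` and `b` represent the same
`f`, `T` sends each of these to `f (q, ∞) ⊓ f (-∞, q) = f ∅ = ⊥`. -/
theorem Rep.eventually_le_of_eq (h : Rep T f a) (h' : Rep T f b) :
    ∀ᶠ z in nullFilter T, a z ≤ b z := by
  let above (q : ℝ) : Opens ℝ := ⟨Set.Ioi q, isOpen_Ioi⟩
  refine eventually_nullFilter.2
    ⟨⨆ q : ℝ, Opens.comap a (above q) ⊓ Opens.comap b (below q), ?_, ?_⟩
  · rw [map_iSup, iSup_eq_bot]
    intro q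
    rw [map_inf, ← h.apply, ← h'.apply, ← map_inf]
    have : above q ⊓ below q = ⊥ := by
      ext x
      simpa [above, below] using fun hx : q < x => hx.le
    rw [this, map_bot]
  · intro z hz
    by_contra! hlt
    obtain ⟨q, hq, hq'⟩ := exists_between hlt
    exact hz (Opens.mem_iSup.2 ⟨q, hq', hq⟩)

/-- This allows hypotheses on elements of `R0 pt` to be used pointwise, whereas `Rep.eq` transfers
only identities valid at every point. -/
theorem Rep.eq_iff (h : Rep T f a) (h' : Rep T g b) :
    f = g ↔ ∀ᶠ z in nullFilter T, a z = b z := by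
  constructor
  · rintro rfl
    filter_upwards [h.eventually_le_of_eq h', h'.eventually_le_of_eq h] with z h1 h2
    exact le_antisymm h1 h2
  · intro hab
    ext U : 2
    rw [h.apply, h'.apply]
    apply le_antisymm <;> apply map_le_of_eventually <;> filter_upwards [hab] with z hz
    · rw [Opens.mem_comap, Opens.mem_comap, hz]; exact id
    · rw [Opens.mem_comap, Opens.mem_comap, hz]; exact id

theorem Rep.le_iff (h : Rep T f a) (h' : Rep T g b) :
    f ≤ g ↔ ∀ᶠ z in nullFilter T, a z ≤ b z := by
  rw [← inf_eq_left]
  refine ((h.inf h').eq_iff h).trans ?_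
  simp

theorem Rep.nonneg_iff (h : Rep T f a) : 0 ≤ f ↔ ∀ᶠ z in nullFilter T, 0 ≤ a z :=
  (Rep.zero T).le_iff h

theorem Rep.trunc (h : Rep T f a) : Rep T (trunc f) ⟨fun z => min (a z) 1, by fun_prop⟩ :=
  h.map _ _

theorem Rep.truncAt (h : Rep T f a) {n : ℕ} (hn : 0 < n) :
    Rep T (truncAt f n) ⟨fun z => min (a z) n, by fun_prop⟩ := by
  have hn' : (0 : ℝ) < n := by exact_mod_cast hn
  have key := (h.smul (1 / (n : ℝ))).trunc.smul (n : ℝ)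
  refine (congrArg (Rep T (R0.truncAt f n)) (ContinuousMap.ext fun z => ?_)).mpr key
  change min (a z) n = n * min (1 / (n : ℝ) * a z) 1
  rw [mul_min_of_nonneg _ _ hn'.le]
  field_simp

theorem add_nonneg (hf : 0 ≤ f) (hg : 0 ≤ g) : 0 ≤ f + g := by
  obtain ⟨T, a, b, c, ha, hb, -⟩ := exists_rep₃ f g g
  rw [(ha.add hb).nonneg_iff]
  filter_upwards [ha.nonneg_iff.1 hf, hb.nonneg_iff.1 hg] with z h1 h2
  exact _root_.add_nonneg h1 h2

theorem trunc_nonneg (hf : 0 ≤ f) : 0 ≤ trunc f := by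
  rw [(rep_id f).trunc.nonneg_iff]
  filter_upwards [(rep_id f).nonneg_iff.1 hf] with z hz
  exact le_min hz zero_le_one

theorem trunc_trunc (f : R0 pt) : trunc (trunc f) = trunc f := by
  refine (rep_id f).trunc.trunc.eq (rep_id f).trunc ?_
  ext z
  simp

theorem nonneg_iff_hom_below : 0 ≤ f ↔ f.hom (below 0) = ⊥ := by
  rw [(rep_id f).nonneg_iff]
  constructor
  · intro h
    rw [← le_bot_iff, ← map_bot f.hom]
    apply map_le_of_eventually
    filter_upwards [h] with x hx hx'
    exact absurd hx' (not_lt.2 hx)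
  · intro h
    exact eventually_nullFilter.2 ⟨_, h, fun x hx => not_lt.1 hx⟩

theorem zero_hom_below_of_pos {r : ℝ} (hr : 0 < r) : (0 : R0 pt).hom (below r) = ⊤ := by
  change (⨆ _ : (0 : ℝ) < r, (⊤ : L)) = ⊤
  simp [hr]

theorem zero_hom_below_of_nonpos {r : ℝ} (hr : r ≤ 0) : (0 : R0 pt).hom (below r) = ⊥ := by
  change (⨆ _ : (0 : ℝ) < r, (⊤ : L)) = ⊥
  simp [hr]

end Transfer

/-! ### Gluing a coherent sequence of truncations -/

section Glue

variable {L : Type*} [Order.Frame L] {pt : FrameHom L Prop} {s : ℕ → R0 pt}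

/-- `U ∩ (-∞, m + 1)`. -/
def cut (U : Opens ℝ) (m : ℕ) : Opens ℝ := U ⊓ below (m + 1)

/-- Where `min (s (m + 1)) (m + 1)` lies below `m + 1`, it equals `s (m + 1)`: below the cut the
sequence has already stabilised. -/
theorem hom_cut_mono (hs : ∀ m, s m = truncAt (s (m + 1)) (m + 1)) (U : Opens ℝ) :
    Monotone fun m => (s m).hom (cut U m) := by
  refine monotone_nat_of_le_succ fun m => ?_
  have h : Rep (s (m + 1)).hom (s m) _ :=
    (hs m) ▸ (rep_id (s (m + 1))).truncAt m.succ_pos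
  rw [h.apply]
  apply OrderHomClass.mono (s (m + 1)).hom
  rintro x ⟨hx, hx'⟩
  change min x ((m + 1 : ℕ) : ℝ) ∈ U at hx
  change min x ((m + 1 : ℕ) : ℝ) < (m : ℝ) + 1 at hx'
  push_cast at hx hx'
  have hlt : x < m + 1 := by simpa using hx'
  rw [min_eq_left hlt.le] at hx
  refine ⟨hx, ?_⟩
  change x < ((m + 1 : ℕ) : ℝ) + 1
  push_cast
  linarith

/-- The limit of a sequence `s` in which `s m` is the truncation of `s (m + 1)` at `m + 1`. -/
def glue (hs : ∀ m, s m = truncAt (s (m + 1)) (m + 1))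
    (htop : ⨆ m : ℕ, (s m).hom (below (m + 1)) = ⊤) : R0 pt where
  hom :=
    { toFun := fun U => ⨆ m, (s m).hom (cut U m)
      map_inf' := fun U V => by
        -- Monotonicity in `m` lets both joins run over a common index, so binary meets commute with
        -- them.
        rw [← iSup_inf_of_monotone (hom_cut_mono hs U) (hom_cut_mono hs V)]
        refine iSup_congr fun m => ?_
        rw [← map_inf]
        congr 1
        exact inf_inf_distrib_right _ _ _
      map_top' := by simpa [cut] using htop
      map_sSup' := fun S => by
        simp only [cut, sSup_inf_eq, sSup_image, map_iSup]
        rw [iSup_comm]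
        exact iSup_congr fun U => iSup_comm }
  pointed U := by
    change pt (⨆ m, (s m).hom (cut U m)) ↔ _
    simp only [map_iSup, iSup_Prop_eq, (s _).pointed]
    constructor
    · rintro ⟨m, h, -⟩
      exact h
    · intro h
      refine ⟨0, h, ?_⟩
      change (0 : ℝ) < (0 : ℕ) + 1
      norm_num

variable (hs : ∀ m, s m = truncAt (s (m + 1)) (m + 1))
  (htop : ⨆ m : ℕ, (s m).hom (below (m + 1)) = ⊤)

theorem glue_nonneg (h0 : ∀ m, 0 ≤ s m) : 0 ≤ glue hs htop := by
  rw [nonneg_iff_hom_below]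
  change ⨆ m, (s m).hom (cut (below 0) m) = ⊥
  rw [iSup_eq_bot]
  intro m
  rw [← le_bot_iff, ← nonneg_iff_hom_below.1 (h0 m)]
  exact OrderHomClass.mono (s m).hom inf_le_left

theorem eq_truncAt_of_lt (hs : ∀ m, s m = truncAt (s (m + 1)) (m + 1)) {k m : ℕ} (hkm : k < m) : s k = truncAt (s m) (k + 1) := by
  induction m, hkm using Nat.le_induction with
  | base => exact hs k
  | succ m hkm ih =>
    have hm := (rep_id (s (m + 1))).truncAt m.succ_pos
    refine ih.trans ?_
    rw [hs m]
    refine (hm.truncAt k.succ_pos).eq ((rep_id (s (m + 1))).truncAt k.succ_pos) ?_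
    ext x
    have : ((k + 1 : ℕ) : ℝ) ≤ ((m + 1 : ℕ) : ℝ) := by exact_mod_cast by omega
    change min (min x ((m + 1 : ℕ) : ℝ)) ((k + 1 : ℕ) : ℝ) = min x ((k + 1 : ℕ) : ℝ)
    rw [min_assoc, min_eq_right this]

/-- The preimage `W` of `U` under `min x (k + 1)` satisfies `s m W = s k U` for all `m > k`. Cutting
`W` at `m + 1` loses nothing in the join, because the cuts of `⊤` join to `⊤`. -/
theorem truncAt_glue (k : ℕ) : truncAt (glue hs htop) (k + 1) = s k := by
  ext U : 2
  rw [((rep_id (glue hs htop)).truncAt k.succ_pos).apply]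
  set W : Opens ℝ := Opens.comap _ U
  change ⨆ m, (s m).hom (cut W m) = _
  have hW : ∀ m, k < m → (s m).hom W = (s k).hom U := by
    intro m hm
    rw [eq_truncAt_of_lt hs hm, ((rep_id (s m)).truncAt k.succ_pos).apply]
  apply le_antisymm
  · refine iSup_le fun m => ?_
    -- By monotonicity `m` may be replaced by an index larger than `k`.
    refine (hom_cut_mono hs W (le_max_left m (k + 1))).trans ?_
    rw [← hW (max m (k + 1)) (by omega)]
    exact OrderHomClass.mono (s _).hom inf_le_left
  · have htop' : ⨆ m, (s m).hom (cut ⊤ m) = ⊤ := by simpa [cut] using htop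
    rw [← inf_top_eq ((s k).hom U), ← htop', inf_iSup_eq]
    refine iSup_le fun m => ?_
    refine (inf_le_inf_left _ (hom_cut_mono hs ⊤ (le_max_left m (k + 1)))).trans ?_
    refine le_trans ?_ (le_iSup _ (max m (k + 1)))
    rw [← hW (max m (k + 1)) (by omega)]
    simp [cut]

end Glue

end R0

open R0

/-! ### Truncation sequences and good sequences -/

section Sequences

variable {L : Type*} [Order.Frame L] {pt : FrameHom L Prop} {G : Subtrunc pt}

theorem partialSums_succ (f : ℕ → R0 pt) (m : ℕ) :
    partialSums f (m + 1) = partialSums f m + f (m + 1) :=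
  Finset.sum_range_succ _ _

theorem partialSums_zero (f : ℕ → R0 pt) : partialSums f 0 = f 0 := by
  simp [partialSums]

theorem partialSums_differences (g : ℕ → R0 pt) : partialSums (differences g) = g := by
  funext m
  induction m with
  | zero => exact partialSums_zero _
  | succ m ih =>
    rw [partialSums_succ, ih]
    exact add_sub_cancel _ _

theorem differences_partialSums (f : ℕ → R0 pt) : differences (partialSums f) = f := by
  funext m
  cases m with
  | zero => exact partialSums_zero _
  | succ m =>
    change partialSums f (m + 1) - partialSums f m = _
    rw [partialSums_succ, add_sub_cancel_left]

/-- Truncation is idempotent, so its range on the positive cone is its set of fixed points there. -/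
theorem mem_truncRange_iff {f : R0 pt} :
    f ∈ G.truncRange ↔ f ∈ G.posCone ∧ trunc f = f := by
  constructor
  · rintro ⟨g, ⟨hg, h0⟩, rfl⟩
    exact ⟨⟨G.trunc_mem g hg h0, trunc_nonneg h0⟩, trunc_trunc g⟩
  · rintro ⟨h, hf⟩
    exact ⟨f, h, hf⟩

theorem differences_mem {g : ℕ → R0 pt} (hg : ∀ k, g k ∈ G.carrier) (k : ℕ) :
    differences g k ∈ G.carrier := by
  cases k with
  | zero => exact hg 0
  | succ k => exact G.toSubmodule.sub_mem (hg (k + 1)) (hg k)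

/-- The formula is restricted to `0 ≤ x` because the term at `k = 0` is `min x 1`, with no cut from
below. -/
theorem rep_differences_truncAt (g₀ : R0 pt) (k : ℕ) :
    ∃ d : C(ℝ, ℝ), Rep g₀.hom (differences (fun k => truncAt g₀ (k + 1)) k) d ∧
      ∀ x, 0 ≤ x → d x = min (max (x - k) 0) 1 := by
  cases k with
  | zero =>
    refine ⟨_, (rep_id g₀).truncAt one_pos, fun x hx => ?_⟩
    change min x ((1 : ℕ) : ℝ) = _
    simp [hx]
  | succ k =>
    refine ⟨_, ((rep_id g₀).truncAt (k + 1).succ_pos).sub ((rep_id g₀).truncAt k.succ_pos),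
      fun x hx => ?_⟩
    change min x ((k + 1 + 1 : ℕ) : ℝ) - min x ((k + 1 : ℕ) : ℝ) = _
    push_cast
    grind

theorem isGoodSeq_differences {g : ℕ → R0 pt} (hg : IsTruncationSeq G g) :
    IsGoodSeq G (differences g) := by
  obtain ⟨hG, g₀, h0, hg₀⟩ := hg
  have hmem := differences_mem fun k => (hG k).1
  obtain rfl : g = fun k => truncAt g₀ (k + 1) := funext hg₀
  choose d hd hd' using rep_differences_truncAt g₀
  have hpos : ∀ᶠ x in nullFilter g₀.hom, 0 ≤ x := (rep_id g₀).nonneg_iff.1 h0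
  have hnonneg : ∀ k, 0 ≤ differences (fun k => truncAt g₀ (k + 1)) k := by
    intro k
    rw [(hd k).nonneg_iff]
    filter_upwards [hpos] with x hx
    rw [hd' k x hx]
    positivity
  refine ⟨fun k => mem_truncRange_iff.2 ⟨⟨hmem k, hnonneg k⟩, ?_⟩, fun k => ?_, fun k => ?_,
    fun r => ?_⟩
  · rw [(hd k).trunc.eq_iff (hd k)]
    filter_upwards [hpos] with x hx
    change min (d k x) 1 = d k x
    rw [hd' k x hx]
    simp
  · rw [(hd k).eq_iff ((hd k).add (hd (k + 1))).trunc]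
    filter_upwards [hpos] with x hx
    change d k x = min (d k x + d (k + 1) x) 1
    rw [hd' k x hx, hd' (k + 1) x hx]
    push_cast
    grind
  · rw [(hd (k + 1)).le_iff (hd k)]
    filter_upwards [hpos] with x hx
    rw [hd' k x hx, hd' (k + 1) x hx]
    push_cast
    grind
  · rcases le_or_gt r 0 with hr | hr
    · rw [zero_hom_below_of_nonpos hr, iSup_eq_bot]
      intro k
      rw [← le_bot_iff, ← nonneg_iff_hom_below.1 (hnonneg k)]
      exact OrderHomClass.mono (R0.hom _) fun x (hx : x < r) => hx.trans_le hr
    · rw [zero_hom_below_of_pos hr, ← top_le_iff]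
      simp only [(hd _).apply]
      rw [← map_iSup, ← map_top g₀.hom]
      apply map_le_of_eventually
      filter_upwards [hpos] with x hx _
      -- As soon as `x ≤ k`, the slice at height `k` vanishes at `x`, hence lies below `r`.
      obtain ⟨k, hk⟩ := exists_nat_ge x
      refine Opens.mem_iSup.2 ⟨k, ?_⟩
      change d k x < r
      rw [hd' k x hx, max_eq_right (by linarith)]
      simpa using hr

theorem partialSums_mem_posCone {f : ℕ → R0 pt} (hf : ∀ k, f k ∈ G.posCone) (m : ℕ) :
    partialSums f m ∈ G.posCone := by
  induction m with
  | zero => rw [partialSums_zero]; exact hf 0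
  | succ m ih =>
    rw [partialSums_succ]
    exact ⟨G.toSubmodule.add_mem ih.1 (hf (m + 1)).1, R0.add_nonneg ih.2 (hf (m + 1)).2⟩

/-- This expresses `partialSums f m ≤ m + 1`: there are `m + 1` summands, each at most `1`. -/
theorem truncAt_partialSums {f : ℕ → R0 pt} (h1 : ∀ k, trunc (f k) = f k) (m : ℕ) :
    truncAt (partialSums f m) (m + 1) = partialSums f m := by
  induction m with
  | zero =>
    rw [partialSums_zero]
    conv_rhs => rw [← h1 0]
    refine ((rep_id (f 0)).truncAt one_pos).eq (rep_id (f 0)).trunc ?_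
    ext x
    simp
  | succ m ih =>
    rw [partialSums_succ]
    obtain ⟨T, a, b, c, ha, hb, -⟩ := exists_rep₃ (partialSums f m) (f (m + 1)) 0
    rw [((ha.add hb).truncAt (m + 1).succ_pos).eq_iff (ha.add hb)]
    filter_upwards [((ha.truncAt m.succ_pos).eq_iff ha).1 ih, (hb.trunc.eq_iff hb).1 (h1 (m + 1))]
      with z hz hz'
    change min (a z) ((m + 1 : ℕ) : ℝ) = a z at hz
    change min (b z) 1 = b z at hz'
    change min (a z + b z) ((m + 1 + 1 : ℕ) : ℝ) = a z + b z
    push_cast at *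
    grind

theorem partialSums_eq_truncAt_succ {f : ℕ → R0 pt} (h0 : ∀ k, 0 ≤ f k)
    (h1 : ∀ k, trunc (f k) = f k) (hf : ∀ k, f k = trunc (f k + f (k + 1))) (m : ℕ) :
    partialSums f m = truncAt (partialSums f (m + 1)) (m + 1) := by
  induction m with
  | zero =>
    rw [partialSums_succ, partialSums_zero]
    conv_lhs => rw [hf 0]
    obtain ⟨T, a, b, c, ha, hb, -⟩ := exists_rep₃ (f 0) (f (0 + 1)) 0
    refine (ha.add hb).trunc.eq ((ha.add hb).truncAt one_pos) ?_
    ext x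
    simp
  | succ m ih =>
    have hbd := truncAt_partialSums h1 m
    rw [partialSums_succ] at ih ⊢
    rw [partialSums_succ f (m + 1), partialSums_succ f m]
    obtain ⟨T, a, b, c, ha, hb, hc⟩ := exists_rep₃ (partialSums f m) (f (m + 1)) (f (m + 1 + 1))
    rw [(ha.add hb).eq_iff (((ha.add hb).add hc).truncAt (m + 1).succ_pos)]
    filter_upwards [(ha.eq_iff ((ha.add hb).truncAt m.succ_pos)).1 ih,
      (hb.eq_iff (hb.add hc).trunc).1 (hf (m + 1)), hb.nonneg_iff.1 (h0 (m + 1)),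
      hc.nonneg_iff.1 (h0 (m + 1 + 1)), ((ha.truncAt m.succ_pos).eq_iff ha).1 hbd]
      with z hz hz' hb0 hc0 hz''
    change a z = min (a z + b z) ((m + 1 : ℕ) : ℝ) at hz
    change b z = min (b z + c z) 1 at hz'
    change min (a z) ((m + 1 : ℕ) : ℝ) = a z at hz''
    change a z + b z = min (a z + b z + c z) ((m + 1 + 1 : ℕ) : ℝ)
    push_cast at *
    -- If `b z = 0`, then `hz'` forces `c z = 0` and the bound on `a z` suffices. If `b z > 0`, then
    -- `hz` forces `a z = m + 1`, and adding `m + 1` to `hz'` gives the goal.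
    grind

/-- The terms before `f m` sum to at most `m`, so the total is below `m + 1` wherever `f m < 1`. -/
theorem hom_below_le_partialSums {f : ℕ → R0 pt} (h1 : ∀ k, trunc (f k) = f k) (m : ℕ) :
    (f m).hom (below 1) ≤ (partialSums f m).hom (below (m + 1)) := by
  cases m with
  | zero => simp [partialSums_zero]
  | succ m =>
    rw [partialSums_succ]
    obtain ⟨T, a, b, c, ha, hb, -⟩ := exists_rep₃ (partialSums f m) (f (m + 1)) 0
    rw [hb.apply, (ha.add hb).apply]
    apply map_le_of_eventually
    filter_upwards [((ha.truncAt m.succ_pos).eq_iff ha).1 (truncAt_partialSums h1 m)]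
      with z hz (hz' : b z < 1)
    change min (a z) ((m + 1 : ℕ) : ℝ) = a z at hz
    change a z + b z < ((m + 1 : ℕ) : ℝ) + 1
    linarith [min_eq_left_iff.1 hz]

theorem isTruncationSeq_partialSums {f : ℕ → R0 pt} (hf : IsGoodSeq G f) :
    IsTruncationSeq G (partialSums f) := by
  obtain ⟨hG, hgood, -, hlim⟩ := hf
  have hpos := fun k => (mem_truncRange_iff.1 (hG k)).1
  have h1 := fun k => (mem_truncRange_iff.1 (hG k)).2
  have hs := partialSums_eq_truncAt_succ (fun k => (hpos k).2) h1 hgood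
  have htop : ⨆ m : ℕ, (partialSums f m).hom (below (m + 1)) = ⊤ := by
    -- Of the convergence to `0` only the instance `r = 1` enters.
    rw [← top_le_iff, ← zero_hom_below_of_pos (pt := pt) one_pos, ← hlim 1]
    exact iSup_mono (hom_below_le_partialSums h1)
  have hmem := partialSums_mem_posCone hpos
  exact ⟨hmem, glue hs htop, glue_nonneg hs htop fun m => (hmem m).2,
    fun k => (truncAt_glue hs htop k).symm⟩

end Sequences

end PointfreeTrunc

theorem proposition27 {L : Type*} [Order.Frame L] (pt : FrameHom L Prop)
    (G : PointfreeTrunc.Subtrunc pt) :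
    (∀ g : ℕ → PointfreeTrunc.R0 pt, PointfreeTrunc.IsTruncationSeq G g →
      PointfreeTrunc.IsGoodSeq G (PointfreeTrunc.differences g)) ∧
    (∀ f : ℕ → PointfreeTrunc.R0 pt, PointfreeTrunc.IsGoodSeq G f →
      PointfreeTrunc.IsTruncationSeq G (PointfreeTrunc.partialSums f)) ∧
    Set.InvOn PointfreeTrunc.partialSums PointfreeTrunc.differences
      {g : ℕ → PointfreeTrunc.R0 pt | PointfreeTrunc.IsTruncationSeq G g}
      {f : ℕ → PointfreeTrunc.R0 pt | PointfreeTrunc.IsGoodSeq G f} ∧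
    Set.BijOn PointfreeTrunc.differences
      {g : ℕ → PointfreeTrunc.R0 pt | PointfreeTrunc.IsTruncationSeq G g}
      {f : ℕ → PointfreeTrunc.R0 pt | PointfreeTrunc.IsGoodSeq G f} := by

  have h : Set.InvOn PointfreeTrunc.partialSums PointfreeTrunc.differences
      {g : ℕ → PointfreeTrunc.R0 pt | PointfreeTrunc.IsTruncationSeq G g}
      {f : ℕ → PointfreeTrunc.R0 pt | PointfreeTrunc.IsGoodSeq G f} :=
    ⟨fun g _ => PointfreeTrunc.partialSums_differences g,
      fun f _ => PointfreeTrunc.differences_partialSums f⟩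
  exact ⟨fun _ => PointfreeTrunc.isGoodSeq_differences,
    fun _ => PointfreeTrunc.isTruncationSeq_partialSums, h,
    h.bijOn (fun _ => PointfreeTrunc.isGoodSeq_differences)
      fun _ => PointfreeTrunc.isTruncationSeq_partialSums⟩
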